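/- All graphs are finite, simple and undirected; $d(u,v)$ denotes the length of a shortest path between $u$ and $v$ and $N_r[v]=\{u\in V(G): d(u,v)\le r\}$. For a connected graph $G$ with at least two vertices, a dominating broadcast is a function $f:V(G)\to\{0,1,\dots,\mathrm{diam}(G)\}$ such that for every vertex $u$ there is a vertex $v$ with $f(v)>0$ and $d(u,v)\le f(v)$; the broadcast domination number $\gamma_b(G)$ is the minimum of $\sum_{v\in V(G)} f(v)$ over all dominating broadcasts $f$. A multipacking is a set $M\subseteq V(G)$ with $|N_r[v]\cap M|\le r$ for every vertex $v$ and every integer $r\ge 1$; the multipacking number $\mathrm{MP}(G)$ is the maximum cardinality of a multipacking. For a real number $\delta$, a connected graph $G$ is $\delta$-hyperbolic if for any four vertices $u,v,w,x$ (not necessarily distinct) the two larger of the three sums $d(u,v)+d(w,x)$, $d(u,w)+d(v,x)$, $d(u,x)+d(v,w)$ differ by at most $2\delta$. A block graph is a graph in which every block (maximal connected subgraph without a cut vertex) is a clique. **Theorem.** 1. The least real number $\delta$ for which $\gamma_b(G)-\mathrm{MP}(G)$ can be arbitrarily large for $\delta$-hyperbolic graphs is $\delta=\tfrac12$. That is,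 for every integer $N\ge 0$ there is a connected $\tfrac12$-hyperbolic graph $G$ with at least two vertices and $\gamma_b(G)-\mathrm{MP}(G)\ge N$, and for every real $\delta<\tfrac12$ this fails: $\gamma_b(G)-\mathrm{MP}(G)$ is bounded over the connected $\delta$-hyperbolic graphs $G$ with at least two vertices. 2. A connected graph is $0$-hyperbolic if and only if it is a block graph. 3. If $G$ is a connected $0$-hyperbolic graph with at least two vertices, then $\gamma_b(G)=\mathrm{MP}(G)$. -/

import Mathlib

namespace BroadcastMultipacking

/-- The closed ball `N_r[v]` of radius `r` around the vertex `v`. -/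
def closedBall {V : Type*} (G : SimpleGraph V) (v : V) (r : ℕ) : Set V :=
  {u | G.dist v u ≤ r}

/-- `f` is a dominating broadcast on `G`: a function with values in `{0, 1, …, diam G}` such that
every vertex `u` hears some tower `v`, that is, `f v > 0` and `d(u, v) ≤ f v`. -/
def IsDominatingBroadcast {V : Type*} (G : SimpleGraph V) (f : V → ℕ) : Prop :=
  (∀ v, f v ≤ G.diam) ∧ ∀ u, ∃ v, 0 < f v ∧ G.dist u v ≤ f v

/-- The broadcast domination number `γ_b(G)`: the minimum cost of a dominating broadcast.
(A dominating broadcast exists on every finite connected graph with at least two vertices.) -/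
noncomputable def broadcastNumber {V : Type*} [Fintype V] (G : SimpleGraph V) : ℕ :=
  sInf {c | ∃ f : V → ℕ, IsDominatingBroadcast G f ∧ ∑ v, f v = c}

/-- `M` is a multipacking of `G`: `|N_r[v] ∩ M| ≤ r` for every vertex `v` and every `r ≥ 1`. -/
def IsMultipacking {V : Type*} (G : SimpleGraph V) (M : Set V) : Prop :=
  ∀ v : V, ∀ r : ℕ, 1 ≤ r → (closedBall G v r ∩ M).ncard ≤ r

/-- The multipacking number `MP(G)`: the maximum cardinality of a multipacking. -/
noncomputable def multipackingNumber {V : Type*} (G : SimpleGraph V) : ℕ :=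
  sSup {c | ∃ M : Set V, IsMultipacking G M ∧ M.ncard = c}

/-- `G` is `δ`-hyperbolic: for any four vertices, the two larger of the three distance sums
`d(u,v) + d(w,x)`, `d(u,w) + d(v,x)`, `d(u,x) + d(v,w)` differ by at most `2δ`. Since all four
vertices are quantified, they may be labelled so that the three sums are in decreasing order. -/
def IsHyperbolic {V : Type*} (G : SimpleGraph V) (δ : ℝ) : Prop :=
  ∀ u v w x : V,
    G.dist u x + G.dist v w ≤ G.dist u w + G.dist v x →
    G.dist u w + G.dist v x ≤ G.dist u v + G.dist w x →
    ((G.dist u v + G.dist w x : ℕ) : ℝ) - ((G.dist u w + G.dist v x : ℕ) : ℝ) ≤ 2 * δ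

/-- The subgraph induced on `S` is connected and has no cut vertex. -/
def IsNonseparable {V : Type*} (G : SimpleGraph V) (S : Set V) : Prop :=
  (G.induce S).Connected ∧ ∀ v ∈ S, (G.induce (S \ {v})).Preconnected

/-- `S` is the vertex set of a block of `G`: a maximal connected subgraph without cut vertex
(such a maximal subgraph is automatically an induced one). -/
def IsBlock {V : Type*} (G : SimpleGraph V) (S : Set V) : Prop :=
  Maximal (IsNonseparable G) S

/-- A block graph: every block is a clique. -/
def IsBlockGraph {V : Type*} (G : SimpleGraph V) : Prop :=
  ∀ S : Set V, IsBlock G S → G.IsClique S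

/-- The difference `γ_b(G) - MP(G)` can be arbitrarily large for (finite, connected)
`δ`-hyperbolic graphs `G` with at least two vertices. -/
def HasUnboundedGap (δ : ℝ) : Prop :=
  ∀ N : ℕ, ∃ (V : Type) (_ : Fintype V) (_ : Nontrivial V) (G : SimpleGraph V),
    G.Connected ∧ IsHyperbolic G δ ∧
      (N : ℤ) ≤ (broadcastNumber G : ℤ) - (multipackingNumber G : ℤ)

end BroadcastMultipacking

open BroadcastMultipacking

/-!
In a graph whose metric satisfies the four-point condition with defect `0`, broadcast domination and
multipacking are integer linear programs dual to each other, and there is no duality gap. Consider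
only the balls containing a vertex `u`, and of each ball only the vertices that are not farther than
`u` from a fixed root: the sets obtained form a chain (`FourPoint.ball_chain`). Hence a greedy
primal-dual procedure, which removes the vertices in order of decreasing distance from the root,
produces an integral packing and an integral cover of the same value (`exists_packing_cover`). The
radius-one balls force the packing to be the indicator function of a set.

The four-point condition with defect `0` characterizes block graphs. If it holds and `u, m, v` is an
induced path, then `d(x, y) < d(x, m) + d(m, y)` defines an equivalence relation on the vertices
other than `m` that contains adjacency but not the pair `u, v`; so `m` separates `u` from `v`, and no
nonseparable set contains such a path. Conversely, in a block graph two vertices that are not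
adjacent are separated by a vertex, because otherwise a cycle would produce a nonseparable set that
is not a clique; moving points to separating vertices reduces the four-point condition to cliques
(`IsBlockGraph.fourPoint`).

As distances are integers, a `δ`-hyperbolic graph with `δ < 1/2` satisfies the four-point condition
with defect `0`, so that the gap `γ_b - MP` vanishes. For `δ = 1/2` the gap is unbounded on a chain
of `k` cells, where a cell is a 3-sun (a central triangle, with an outer vertex joined to both ends of
each of its edges) followed by a path with three vertices. Four-point conditions survive gluing along
paths (`FourPoint.union`), so it suffices to inspect a single cell. The closed neighbourhoods of the
central vertices of the sun allow one vertex of a multipacking in each sun, and one more fits on each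
path, so `MP ≤ 2k`. But the fractional multipacking with weights `1/2` on the outer vertices of the
sun and `1/4` on the path has total weight `9/4` on each cell, so `γ_b ≥ 9k/4` by weak duality
(`sum_weight_le`).
-/

namespace BroadcastMultipacking

/-! ### The four-point condition and weak duality -/

/-- The four-point condition with defect `c` on the set `S`: of the three pairings of four points,
no sum of distances exceeds the larger of the other two by more than `c`. -/
def FourPoint {α : Type*} (d : α → α → ℕ) (c : ℕ) (S : Set α) : Prop :=
  ∀ u ∈ S, ∀ v ∈ S, ∀ w ∈ S, ∀ x ∈ S,
    d u v + d w x ≤ max (d u w + d v x) (d u x + d v w) + c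

/-- Distance sums are integers, so only the integer part of `2δ` matters. -/
lemma IsHyperbolic.fourPoint {V : Type*} {G : SimpleGraph V} {δ : ℝ} {c : ℕ}
    (h : IsHyperbolic G δ) (hc : 2 * δ < c + 1) : FourPoint G.dist c Set.univ := by
  intro u _ v _ w _ x _
  by_contra! hlt
  have key : ∀ s t : ℕ, s + c < t → ¬ ((t : ℝ) - (s : ℝ) ≤ 2 * δ) := by
    intro s t hst hle
    have : ((s + c + 1 : ℕ) : ℝ) ≤ t := by exact_mod_cast hst
    push_cast at this
    linarith
  rcases le_total (G.dist u x + G.dist v w) (G.dist u w + G.dist v x) with h1 | h1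
  · exact key _ _ (by omega) (h u v w x h1 (by omega))
  · have hxw : G.dist x w = G.dist w x := G.dist_comm
    exact key _ _ (by omega) (h u v x w h1 (by omega))

lemma FourPoint.isHyperbolic {V : Type*} {G : SimpleGraph V} {δ : ℝ} {c : ℕ}
    (h : FourPoint G.dist c Set.univ) (hc : c ≤ 2 * δ) : IsHyperbolic G δ := by
  intro u v w x h1 h2
  have h3 := h u trivial v trivial w trivial x trivial
  rw [max_eq_left h1] at h3
  have h4 : ((G.dist u v + G.dist w x : ℕ) : ℝ) ≤ ((G.dist u w + G.dist v x + c : ℕ) : ℝ) := by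
    exact_mod_cast h3
  rw [Nat.cast_add _ c] at h4
  linarith

lemma multipackingNumber_le {V : Type*} {G : SimpleGraph V} {b : ℕ}
    (h : ∀ M : Set V, IsMultipacking G M → M.ncard ≤ b) :
    multipackingNumber G ≤ b := by
  refine csSup_le ⟨0, ∅, fun v r _ => by simp, by simp⟩ ?_
  rintro c ⟨M, hM, rfl⟩
  exact h M hM

section Duality

variable {V : Type*} [Fintype V] {G : SimpleGraph V}

lemma dist_le_diam (hG : G.Connected) (u v : V) : G.dist u v ≤ G.diam := by
  have := hG.nonempty
  exact SimpleGraph.dist_le_diam (SimpleGraph.connected_iff_ediam_ne_top.mp hG)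

lemma one_le_diam [Nontrivial V] (hG : G.Connected) : 1 ≤ G.diam := by
  obtain ⟨a, b, hab⟩ := exists_pair_ne V
  exact (hG.pos_dist_of_ne hab).trans_le (dist_le_diam hG a b)

/-- The minimum defining `γ_b(G)` is over a nonempty set, hence attained. -/
lemma exists_broadcast_eq [Nontrivial V] (hG : G.Connected) :
    ∃ f : V → ℕ, IsDominatingBroadcast G f ∧ ∑ v, f v = broadcastNumber G := by
  have hne : {c | ∃ f : V → ℕ, IsDominatingBroadcast G f ∧ ∑ v, f v = c}.Nonempty :=
    ⟨_, fun _ => G.diam, ⟨fun _ => le_rfl, fun u => ⟨u, one_le_diam hG, by simp⟩⟩, rfl⟩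
  exact Nat.sInf_mem hne

lemma broadcastNumber_le {f : V → ℕ} (hf : IsDominatingBroadcast G f) :
    broadcastNumber G ≤ ∑ v, f v :=
  Nat.sInf_le ⟨f, hf, rfl⟩

lemma IsMultipacking.ncard_le {M : Set V} (hM : IsMultipacking G M) :
    M.ncard ≤ multipackingNumber G := by
  refine le_csSup ⟨Nat.card V, ?_⟩ ⟨M, hM, rfl⟩
  rintro c ⟨M, -, rfl⟩
  exact Set.ncard_le_card M

open Classical in
/-- Weak linear programming duality: a weighting of the vertices that puts weight at most `D * r` on
every ball of radius `r ≥ 1` has total weight at most `D` times the cost of any dominating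
broadcast. -/
lemma sum_weight_le {w : V → ℕ} {D : ℕ}
    (hw : ∀ v r, 1 ≤ r → ∑ u with G.dist v u ≤ r, w u ≤ D * r)
    {f : V → ℕ} (hf : IsDominatingBroadcast G f) : ∑ u, w u ≤ D * ∑ v, f v := by
  choose t ht0 ht using hf.2
  rw [← Finset.sum_fiberwise _ t, Finset.mul_sum]
  refine Finset.sum_le_sum fun v _ => ?_
  rcases Nat.eq_zero_or_pos (f v) with h0 | h0
  · rw [Finset.filter_false_of_mem]
    · simp
    · rintro u - rfl
      exact (ht0 u).ne' h0
  · refine (Finset.sum_le_sum_of_subset fun u hu => ?_).trans (hw v (f v) h0)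
    obtain rfl : t u = v := by simpa using hu
    simpa [SimpleGraph.dist_comm] using ht u

open Classical in
lemma sum_ball_indicator (M : Set V) (v : V) (r : ℕ) :
    ∑ u with G.dist v u ≤ r, (if u ∈ M then 1 else 0) = (closedBall G v r ∩ M).ncard := by
  rw [Finset.sum_boole, Nat.cast_id, ← Set.ncard_coe_finset]
  congr 1
  ext u
  simp [closedBall]

lemma multipackingNumber_le_broadcastNumber [Nontrivial V] (hG : G.Connected) :
    multipackingNumber G ≤ broadcastNumber G := by
  classical
  refine multipackingNumber_le fun M hM => ?_
  obtain ⟨f, hf, hsum⟩ := exists_broadcast_eq hG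
  have h := sum_weight_le (G := G) (w := fun u => if u ∈ M then 1 else 0) (D := 1)
    (fun v r hr => by
      rw [sum_ball_indicator]
      simpa using hM v r hr) hf
  rw [Finset.sum_boole, Nat.cast_id, one_mul, hsum] at h
  rwa [← Set.ncard_coe_finset, Finset.coe_filter_univ, Set.ofPred_mem_eq] at h

end Duality

/-! ### Strong duality in tree-like metrics -/

open Classical in
/-- Integral linear programming duality for covering by a family of sets `B i` with costs `c i`,
under the condition that the sets containing a point `u` form a chain once they are restricted to
the points of height at most `h u`. Points are removed from `U` in order of decreasing height: the
highest point `a` gets as weight the least cost of a set containing it, this amount is subtracted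
from the cost of every set containing `a`, and the chain condition lets an optimal cover of the
remaining points be modified so that exactly one of its sets contains `a`. -/
theorem exists_packing_cover {V ι : Type*} [Fintype ι] (B : ι → Set V) (h : V → ℕ)
    (chain : ∀ u i j, u ∈ B i → u ∈ B j →
      (∀ w ∈ B i, h w ≤ h u → w ∈ B j) ∨ (∀ w ∈ B j, h w ≤ h u → w ∈ B i))
    (cov : ∀ u, ∃ i, u ∈ B i) (U : Finset V) :
    ∀ c : ι → ℕ, ∃ y : V → ℕ, (∀ i, ∑ u ∈ U with u ∈ B i, y u ≤ c i) ∧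
      ∃ C : Finset ι, (∀ u ∈ U, ∃ i ∈ C, u ∈ B i) ∧ ∑ i ∈ C, c i ≤ ∑ u ∈ U, y u := by
  induction U using Finset.induction_on_max_value h with
  | empty => exact fun c => ⟨0, by simp, ∅, by simp, by simp⟩
  | insert a s has hmax ih =>
    intro c
    obtain ⟨i₀, hi₀, hmin⟩ := Finset.exists_min_image (Finset.univ.filter fun i => a ∈ B i) c
      (by obtain ⟨i, hi⟩ := cov a; exact ⟨i, by simpa using hi⟩)
    simp only [Finset.mem_filter, Finset.mem_univ, true_and] at hi₀ hmin
    set c' : ι → ℕ := fun i => if a ∈ B i then c i - c i₀ else c i with hc'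
    have hc'_mem : ∀ i, a ∈ B i → c' i + c i₀ = c i := by
      intro i hi
      have := hmin i hi
      simp only [hc', if_pos hi]
      omega
    have hc'_notMem : ∀ i, a ∉ B i → c' i = c i := fun i hi => if_neg hi
    obtain ⟨y, hy, C, hC, hcost⟩ := ih c'
    have hyu : ∀ u ∈ s, Function.update y a (c i₀) u = y u := fun u hu =>
      Function.update_of_ne (ne_of_mem_of_not_mem hu has) _ _
    refine ⟨Function.update y a (c i₀), fun i => ?_, ?_⟩
    · have hs : ∑ u ∈ s with u ∈ B i, Function.update y a (c i₀) u ≤ c' i :=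
        (Finset.sum_congr rfl fun u hu => hyu u (Finset.mem_of_mem_filter u hu)).trans_le (hy i)
      by_cases hai : a ∈ B i
      · rw [Finset.filter_insert, if_pos hai, Finset.sum_insert (by simp [has]),
          Function.update_self, ← hc'_mem i hai]
        omega
      · rw [Finset.filter_insert, if_neg hai, ← hc'_notMem i hai]
        exact hs
    · -- The sets of the cover that contain `a` are replaced by the largest one of them.
      obtain ⟨i₁, hai₁, hbig, hle⟩ : ∃ i₁, a ∈ B i₁ ∧
          (∀ i ∈ C, a ∈ B i → ∀ u ∈ s, u ∈ B i → u ∈ B i₁) ∧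
          c' i₁ + ∑ i ∈ C with a ∉ B i, c' i ≤ ∑ i ∈ C, c' i := by
        have hsplit := Finset.sum_filter_add_sum_filter_not C (fun i => a ∈ B i) c'
        rcases (C.filter fun i => a ∈ B i).eq_empty_or_nonempty with hK | hK
        · refine ⟨i₀, hi₀, fun i hi hai => ?_, ?_⟩
          · exact absurd hai (Finset.filter_eq_empty_iff.1 hK hi)
          · have := hc'_mem i₀ hi₀
            omega
        · obtain ⟨i₁, hi₁, hm⟩ := Finset.exists_max_image _
            (fun i => (s.filter fun u => u ∈ B i).card) hK
          have hai₁ := (Finset.mem_filter.1 hi₁).2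
          refine ⟨i₁, hai₁, fun i hi hai => ?_, ?_⟩
          · rcases chain a i i₁ hai hai₁ with hch | hch
            · exact fun u hu hui => hch u hui (hmax u hu)
            · have hsub : (s.filter fun u => u ∈ B i₁) ⊆ s.filter fun u => u ∈ B i := by
                intro u hu
                rw [Finset.mem_filter] at hu ⊢
                exact ⟨hu.1, hch u hu.2 (hmax u hu.1)⟩
              have heq := Finset.eq_of_subset_of_card_le hsub
                (hm i (Finset.mem_filter.2 ⟨hi, hai⟩))
              intro u hu hui
              have : u ∈ s.filter fun u => u ∈ B i₁ := heq ▸ Finset.mem_filter.2 ⟨hu, hui⟩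
              exact (Finset.mem_filter.1 this).2
          · have := Finset.single_le_sum (f := c') (fun _ _ => Nat.zero_le _) hi₁
            omega
      refine ⟨insert i₁ (C.filter fun i => a ∉ B i), fun u hu => ?_, ?_⟩
      · rcases Finset.mem_insert.1 hu with rfl | hu
        · exact ⟨i₁, Finset.mem_insert_self _ _, hai₁⟩
        · obtain ⟨i, hi, hui⟩ := hC u hu
          by_cases hai : a ∈ B i
          · exact ⟨i₁, Finset.mem_insert_self _ _, hbig i hi hai u hu hui⟩
          · exact ⟨i, Finset.mem_insert_of_mem (Finset.mem_filter.2 ⟨hi, hai⟩), hui⟩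
      · rw [Finset.sum_insert (by simp [hai₁]), Finset.sum_insert has, Function.update_self,
          ← hc'_mem i₁ hai₁]
        have : ∑ i ∈ C with a ∉ B i, c i = ∑ i ∈ C with a ∉ B i, c' i :=
          Finset.sum_congr rfl fun i hi => (hc'_notMem i (Finset.mem_filter.1 hi).2).symm
        have hyv : ∑ u ∈ s, Function.update y a (c i₀) u = ∑ u ∈ s, y u :=
          Finset.sum_congr rfl hyu
        omega

/-- In a tree-like metric, the balls containing a point `u` form a chain once they are restricted to
the points that are not farther than `u` from a fixed root `o`. -/
lemma FourPoint.ball_chain {α : Type*} {d : α → α → ℕ} (h : FourPoint d 0 Set.univ)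
    (hsymm : ∀ x y, d x y = d y x) (o u v₁ v₂ : α) (r₁ r₂ : ℕ)
    (h₁ : d v₁ u ≤ r₁) (h₂ : d v₂ u ≤ r₂) :
    (∀ w, d v₁ w ≤ r₁ → d o w ≤ d o u → d v₂ w ≤ r₂) ∨
      (∀ w, d v₂ w ≤ r₂ → d o w ≤ d o u → d v₁ w ≤ r₁) := by
  by_contra! hcon
  obtain ⟨⟨w₁, h11, ho1, h21⟩, ⟨w₂, h22, ho2, h12⟩⟩ := hcon
  have F : ∀ x y z, d o x + d y z ≤ max (d o y + d x z) (d o z + d x y) := fun x y z =>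
    h o trivial x trivial y trivial z trivial
  have := hsymm w₂ u
  have := hsymm w₁ u
  -- In terms of the Gromov products `(x|y)` at `o`, the hypotheses on `w₂` give
  -- `(v₁|u) > (v₁|w₂)`, hence `(v₁|w₂) = (u|w₂)`; likewise `(v₂|w₁) = (u|w₁)`.
  have e₁ : d v₁ w₂ + d o u = d o v₁ + d u w₂ := by
    have := F u v₁ w₂
    have := F v₁ u w₂
    have := hsymm u v₁
    omega
  have e₂ : d v₂ w₁ + d o u = d o v₂ + d u w₁ := by
    have := F u v₂ w₁
    have := F v₂ u w₁
    have := hsymm u v₂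
    omega
  -- The ultrametric inequality `(u|wᵢ) ≥ min (vᵢ|wᵢ) (u|vᵢ)`.
  have := F v₁ u w₁
  have := F v₂ u w₂
  omega

theorem broadcastNumber_eq_multipackingNumber {V : Type*} [Fintype V] [Nontrivial V]
    {G : SimpleGraph V} (hG : G.Connected) (h : FourPoint G.dist 0 Set.univ) :
    broadcastNumber G = multipackingNumber G := by
  classical
  refine le_antisymm ?_ (multipackingNumber_le_broadcastNumber hG)
  obtain ⟨o⟩ := hG.nonempty
  have hdiam := one_le_diam hG
  -- The covering sets are the balls of radius between `1` and the diameter, the radius being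
  -- one more than the index.
  let c : V × Fin G.diam → ℕ := fun i => i.2 + 1
  obtain ⟨y, hy, C, hC, hcost⟩ := exists_packing_cover
    (fun i : V × Fin G.diam => {u | G.dist i.1 u ≤ c i}) (fun w => G.dist o w)
    (fun u i j hi hj => h.ball_chain (fun _ _ => G.dist_comm) o u i.1 j.1 (c i) (c j) hi hj)
    (fun u => ⟨(u, ⟨0, hdiam⟩), by simp⟩) Finset.univ c
  simp only [Set.mem_ofPred_eq] at hy hC
  have hy1 : ∀ u, y u ≤ 1 := fun u =>
    (Finset.single_le_sum (f := y) (fun _ _ => Nat.zero_le _) (by simp)).trans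
      (hy (u, ⟨0, hdiam⟩))
  obtain ⟨M, hMy⟩ : ∃ M : Set V, ∀ u, u ∈ M ↔ y u = 1 := ⟨{u | y u = 1}, fun u => Iff.rfl⟩
  have hyM : ∀ u, y u = if u ∈ M then 1 else 0 := by
    intro u
    have := hy1 u
    rw [if_congr (hMy u) rfl rfl]
    split_ifs <;> omega
  have hM : IsMultipacking G M := by
    have hsmall : ∀ v r, 1 ≤ r → r ≤ G.diam → (closedBall G v r ∩ M).ncard ≤ r := by
      intro v r hr hrd
      have := hy (v, ⟨r - 1, by omega⟩)
      simp only [c, Nat.sub_add_cancel hr] at this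
      rwa [← sum_ball_indicator, ← Finset.sum_congr rfl fun u _ => hyM u]
    intro v r hr
    rcases le_total r G.diam with hrd | hrd
    · exact hsmall v r hr hrd
    · refine le_trans (Set.ncard_le_ncard ?_ (Set.toFinite _)) ((hsmall v _ hdiam le_rfl).trans hrd)
      exact Set.inter_subset_inter_left _ fun u _ => dist_le_diam hG v u
  have hMcard : M.ncard = ∑ u, y u := by
    rw [Finset.sum_congr rfl fun u _ => hyM u, Finset.sum_boole, Nat.cast_id,
      ← Set.ncard_coe_finset, Finset.coe_filter_univ, Set.ofPred_mem_eq]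
  -- Several balls of the cover may share their centre: the broadcast takes the largest radius.
  let f : V → ℕ := fun v => (C.filter fun i => i.1 = v).sup c
  have hf : IsDominatingBroadcast G f := by
    refine ⟨fun v => Finset.sup_le fun i _ => i.2.2, fun u => ?_⟩
    obtain ⟨i, hi, hiu⟩ := hC u (Finset.mem_univ u)
    have hle : c i ≤ f i.1 := Finset.le_sup (f := c) (Finset.mem_filter.2 ⟨hi, rfl⟩)
    exact ⟨i.1, (Nat.succ_pos _).trans_le hle, (G.dist_comm.trans_le hiu).trans hle⟩
  calc broadcastNumber G ≤ ∑ v, f v := broadcastNumber_le hf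
    _ ≤ ∑ v, ∑ i ∈ C with i.1 = v, c i := Finset.sum_le_sum fun v _ =>
        Finset.sup_le fun i hi => Finset.single_le_sum (f := c) (fun _ _ => Nat.zero_le _) hi
    _ = ∑ i ∈ C, c i := Finset.sum_fiberwise _ _ _
    _ ≤ ∑ u, y u := hcost
    _ = M.ncard := hMcard.symm
    _ ≤ multipackingNumber G := hM.ncard_le

/-! ### Block graphs -/

section BlockGraph

variable {V : Type*} {G : SimpleGraph V}

/-- In a tree-like metric, a vertex `m` lying strictly between `u` and `v` separates them: for
`x, y ≠ m` the relation `d(x, y) < d(x, m) + d(m, y)` is transitive by the four-point condition and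
holds for adjacent vertices, so it is preserved along walks that avoid `m`. -/
lemma FourPoint.dist_lt_of_walk (hG : G.Connected) (h : FourPoint G.dist 0 Set.univ)
    {u v m : V} (hmv : m ≠ v) (p : G.Walk v u) (hp : m ∉ p.support) :
    G.dist u v < G.dist u m + G.dist m v := by
  induction p with
  | nil =>
    have := hG.pos_dist_of_ne hmv
    simp only [SimpleGraph.dist_self]
    omega
  | @cons a b c hab p ih =>
    rw [SimpleGraph.Walk.support_cons, List.mem_cons, not_or] at hp
    have hmb : m ≠ b := fun e => hp.2 (e ▸ p.start_mem_support)
    have h1 := ih hmb hp.2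
    have h2 := hG.pos_dist_of_ne hmb
    have h3 := hG.pos_dist_of_ne hmv
    have h4 := SimpleGraph.dist_eq_one_iff_adj.2 hab
    have h5 := h a trivial c trivial b trivial m trivial
    have h6 : G.dist m a = G.dist a m := G.dist_comm
    have h7 : G.dist m b = G.dist b m := G.dist_comm
    have h8 : G.dist c b = G.dist b c := G.dist_comm
    have h9 : G.dist c a = G.dist a c := G.dist_comm
    omega

/-- A connected induced subgraph that is not a clique contains an induced path with three
vertices. -/
lemma exists_induced_path_of_not_isClique {S : Set V} (hS : (G.induce S).Preconnected)
    (hc : ¬ G.IsClique S) :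
    ∃ u ∈ S, ∃ m ∈ S, ∃ v ∈ S, G.Adj u m ∧ G.Adj m v ∧ u ≠ v ∧ ¬ G.Adj u v := by
  by_contra! hcon
  apply hc
  have key : ∀ a b : S, (G.induce S).Walk a b → a = b ∨ G.Adj a b := by
    intro a b p
    induction p with
    | nil => exact .inl rfl
    | @cons a b c hab p ih =>
      have hab' : G.Adj a b := hab
      rcases ih with rfl | hbc
      · exact .inr hab'
      · by_cases hac : (a : V) = c
        · exact .inl (Subtype.ext hac)
        · exact .inr (hcon a a.2 b b.2 c c.2 hab' hbc hac)
  intro a ha b hb hab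
  obtain ⟨p⟩ := hS ⟨a, ha⟩ ⟨b, hb⟩
  exact (key _ _ p).resolve_left fun e => hab (congrArg Subtype.val e)

/-- In a tree-like graph a nonseparable set is a clique: otherwise it contains an induced path
`u, m, v`, and `m` is a cut vertex. -/
lemma IsNonseparable.isClique_of_fourPoint (hG : G.Connected) (h : FourPoint G.dist 0 Set.univ)
    {S : Set V} (hS : IsNonseparable G S) : G.IsClique S := by
  by_contra hc
  obtain ⟨u, hu, m, hm, v, hv, hum, hmv, huv, hadj⟩ :=
    exists_induced_path_of_not_isClique hS.1.preconnected hc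
  obtain ⟨p⟩ := hS.2 m hm ⟨v, hv, hmv.ne'⟩ ⟨u, hu, hum.ne⟩
  have hp : m ∉ (p.map (SimpleGraph.Embedding.induce _).toHom).support := by
    rw [SimpleGraph.Walk.support_map, List.mem_map]
    rintro ⟨x, -, hx⟩
    exact x.2.2 hx
  have h1 : G.dist u v < G.dist u m + G.dist m v :=
    h.dist_lt_of_walk hG hmv.ne (p.map (SimpleGraph.Embedding.induce _).toHom) hp
  have h2 := hG.pos_dist_of_ne huv
  have h3 : G.dist u v ≠ 1 := fun e => hadj (SimpleGraph.dist_eq_one_iff_adj.1 e)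
  have h4 := SimpleGraph.dist_eq_one_iff_adj.2 hum
  have h5 := SimpleGraph.dist_eq_one_iff_adj.2 hmv
  omega

lemma IsBlockGraph.isClique [Finite V] (h : IsBlockGraph G) {S : Set V}
    (hS : IsNonseparable G S) : G.IsClique S := by
  obtain ⟨T, hST, hT⟩ := (Set.toFinite {S | IsNonseparable G S}).exists_le_maximal hS
  exact (h T hT).subset hST

/-- A path from `u` to `v` together with a vertex adjacent to both ends is a cycle, hence
nonseparable. -/
lemma isNonseparable_cycle {u v m : V} (hum : G.Adj u m) (hmv : G.Adj m v) (p : G.Walk u v)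
    (hp : p.IsPath) (hm : m ∉ p.support) : IsNonseparable G {x | x = m ∨ x ∈ p.support} := by
  classical
  set S : Set V := {x | x = m ∨ x ∈ p.support} with hS
  -- Removing `q ≠ m` leaves every other vertex joined to `m` through one of the two ends.
  have hreach : ∀ q, ∀ y ∈ p.support, y ≠ q →
      (∃ w : G.Walk y u, ∀ x ∈ w.support, x ∈ p.support ∧ x ≠ q) ∨
      (∃ w : G.Walk y v, ∀ x ∈ w.support, x ∈ p.support ∧ x ≠ q) := by
    intro q y hy hyq
    have hdis : q ∉ (p.takeUntil y hy).support ∨ q ∉ (p.dropUntil y hy).support := by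
      by_contra! hcon
      have hnd := hp.support_nodup
      rw [← p.take_spec hy, SimpleGraph.Walk.support_append, List.nodup_append'] at hnd
      have hq := hcon.2
      rw [← SimpleGraph.Walk.cons_tail_support, List.mem_cons] at hq
      exact hnd.2.2 hcon.1 (hq.resolve_left hyq.symm)
    rcases hdis with hq | hq
    · refine .inl ⟨(p.takeUntil y hy).reverse, fun x hx => ?_⟩
      rw [SimpleGraph.Walk.support_reverse, List.mem_reverse] at hx
      exact ⟨p.support_takeUntil_subset_support hy hx, fun e => hq (e ▸ hx)⟩
    · exact .inr ⟨p.dropUntil y hy, fun x hx =>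
        ⟨p.support_dropUntil_subset_support hy hx, fun e => hq (e ▸ hx)⟩⟩
  have hto : ∀ (q : V) (hqm : m ≠ q) (y : ↥(S \ {q})),
      (G.induce (S \ {q})).Reachable y ⟨m, .inl rfl, hqm⟩ := by
    rintro q hqm ⟨y, hyS, hyq⟩
    rcases hyS with rfl | hy
    · exact SimpleGraph.Reachable.refl _
    · have hend : ∀ e, G.Adj e m → (∃ w : G.Walk y e, ∀ x ∈ w.support, x ∈ p.support ∧ x ≠ q) →
          (G.induce (S \ {q})).Reachable ⟨y, .inr hy, hyq⟩ ⟨m, .inl rfl, hqm⟩ := by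
        rintro e hem ⟨w, hw⟩
        have hw' : ∀ x ∈ (w.concat hem).support, x ∈ S \ {q} := by
          intro x hx
          rw [SimpleGraph.Walk.support_concat, List.mem_append,
            List.mem_singleton] at hx
          rcases hx with hx | rfl
          · exact ⟨.inr (hw x hx).1, (hw x hx).2⟩
          · exact ⟨.inl rfl, hqm⟩
        exact ⟨(w.concat hem).induce _ hw'⟩
      rcases hreach q y hy hyq with h | h
      · exact hend u hum h
      · exact hend v hmv.symm h
  have hpre : ∀ q ∈ S, (G.induce (S \ {q})).Preconnected := by
    intro q hq
    by_cases hqm : q = m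
    · subst hqm
      have : S \ {q} = {x | x ∈ p.support} := by
        ext x
        simp only [hS, Set.mem_sdiff, Set.mem_ofPred_eq, Set.mem_singleton_iff]
        constructor
        · rintro ⟨h1 | h1, h2⟩
          · exact absurd h1 h2
          · exact h1
        · exact fun h => ⟨.inr h, fun e => hm (e ▸ h)⟩
      rw [this]
      exact p.connected_induce_support.preconnected
    · intro x y
      exact (hto q (Ne.symm hqm) x).trans (hto q (Ne.symm hqm) y).symm
  refine ⟨?_, hpre⟩
  have hS' : S = {m} ∪ {x | x ∈ p.support} := rfl
  rw [hS']
  refine SimpleGraph.connected_induce_union ?_ p.connected_induce_support.preconnected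
    (Set.mem_singleton m) p.start_mem_support hum.symm
  rintro ⟨x, rfl⟩ ⟨y, rfl⟩
  exact SimpleGraph.Reachable.refl _

/-- `m` separates `x` from `y`: every walk from `x` to `y` passes through `m`. In particular every
vertex separates itself from all others. -/
def Separates (G : SimpleGraph V) (m x y : V) : Prop :=
  ∀ p : G.Walk x y, m ∈ p.support

lemma Separates.symm {m x y : V} (h : Separates G m x y) : Separates G m y x := by
  intro p
  have := h p.reverse
  rwa [SimpleGraph.Walk.support_reverse, List.mem_reverse] at this

lemma Separates.or {m x y : V} (h : Separates G m x y) (z : V) :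
    Separates G m x z ∨ Separates G m z y := by
  by_contra! hcon
  simp only [Separates, not_forall] at hcon
  obtain ⟨⟨p, hp⟩, ⟨q, hq⟩⟩ := hcon
  have := h (p.append q)
  rw [SimpleGraph.Walk.mem_support_append_iff] at this
  exact this.elim hp hq

lemma Separates.dist_eq (hG : G.Connected) {m x y : V} (h : Separates G m x y) :
    G.dist x y = G.dist x m + G.dist m y := by
  classical
  refine le_antisymm hG.dist_triangle ?_
  obtain ⟨p, hp⟩ := hG.exists_walk_length_eq_dist x y
  have hm := h p
  have := congrArg SimpleGraph.Walk.length (p.take_spec hm)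
  rw [SimpleGraph.Walk.length_append] at this
  have h1 := SimpleGraph.dist_le (p.takeUntil m hm)
  have h2 := SimpleGraph.dist_le (p.dropUntil m hm)
  omega

lemma IsBlockGraph.separates [Finite V] (h : IsBlockGraph G) {u m v : V} (hum : G.Adj u m)
    (hmv : G.Adj m v) (huv : u ≠ v) (hadj : ¬ G.Adj u v) : Separates G m u v := by
  classical
  intro p
  by_contra hm
  have hS := isNonseparable_cycle hum hmv p.bypass p.bypass_isPath
    fun hmem => hm (p.support_bypass_subset_support hmem)
  exact hadj (h.isClique hS (.inr (SimpleGraph.Walk.start_mem_support _))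
    (.inr (SimpleGraph.Walk.end_mem_support _)) huv)

lemma IsBlockGraph.exists_separates [Finite V] (h : IsBlockGraph G) (hG : G.Connected) {x y : V}
    (hxy : 2 ≤ G.dist x y) : ∃ m, m ≠ x ∧ m ≠ y ∧ Separates G m x y := by
  obtain ⟨p, hp, hlen⟩ := hG.exists_path_of_dist x y
  match p, hp, hlen with
  | .nil, _, hlen => simp at hxy
  | .cons h1 .nil, _, hlen => simp at hlen; omega
  | .cons (v := m) h1 (.cons (v := t) h2 p), hp, hlen =>
    rw [SimpleGraph.Walk.length_cons, SimpleGraph.Walk.length_cons] at hlen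
    rw [SimpleGraph.Walk.cons_isPath_iff, SimpleGraph.Walk.cons_isPath_iff,
      SimpleGraph.Walk.support_cons, List.mem_cons, not_or] at hp
    obtain ⟨⟨-, hmp⟩, hxm, hxp⟩ := hp
    refine ⟨m, Ne.symm hxm, fun e => hmp (e ▸ p.end_mem_support), ?_⟩
    have hsep : Separates G m x t := by
      refine h.separates h1 h2 (fun e => hxp (e ▸ p.start_mem_support)) fun hadj => ?_
      have := SimpleGraph.dist_le (SimpleGraph.Walk.cons hadj p)
      rw [SimpleGraph.Walk.length_cons] at this
      omega
    rcases hsep.or y with h3 | h3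
    · exact h3
    · have := h3 p.reverse
      rw [SimpleGraph.Walk.support_reverse, List.mem_reverse] at this
      exact absurd this hmp

/-- A connected block graph is tree-like. By induction on the sum of the six distances between four
points: if two of the points are not adjacent, they are separated by some vertex `m`. Either `m`
separates one of the points from the three others, and this point can be moved to `m`; or `m`
separates two of the points from the two others, and then the two largest sums are equal because all
four distances they involve are measured through `m`. -/
lemma IsBlockGraph.fourPoint [Finite V] (h : IsBlockGraph G) (hG : G.Connected) :
    FourPoint G.dist 0 Set.univ := by
  suffices H : ∀ n a b c e, G.dist a b + G.dist a c + G.dist a e + G.dist b c + G.dist b e +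
      G.dist c e = n → G.dist a b + G.dist c e ≤
        max (G.dist a c + G.dist b e) (G.dist a e + G.dist b c) by
    intro u _ v _ w _ x _
    exact H _ u v w x rfl
  intro n
  induction n using Nat.strong_induction_on with
  | _ n ih =>
  have tri : ∀ x y z, G.dist x z ≤ G.dist x y + G.dist y z := fun x y z => hG.dist_triangle
  have comm : ∀ x y, G.dist x y = G.dist y x := fun x y => G.dist_comm
  -- Any of the three sums is at most the maximum of the two others.
  let Q : V → V → V → V → Prop := fun a b c e =>
    G.dist a b + G.dist c e ≤ max (G.dist a c + G.dist b e) (G.dist a e + G.dist b c) ∧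
    G.dist a c + G.dist b e ≤ max (G.dist a b + G.dist c e) (G.dist a e + G.dist b c) ∧
    G.dist a e + G.dist b c ≤ max (G.dist a b + G.dist c e) (G.dist a c + G.dist b e)
  have move : ∀ m a b c e, G.dist a b + G.dist a c + G.dist a e + G.dist b c + G.dist b e +
      G.dist c e = n → m ≠ a → Separates G m a b → Separates G m a c → Separates G m a e →
      Q a b c e := by
    intro m a b c e hn hma hb hc he
    have h1 := hb.dist_eq hG
    have h2 := hc.dist_eq hG
    have h3 := he.dist_eq hG
    have h4 := hG.pos_dist_of_ne hma.symm
    have q1 := ih _ (by omega) m b c e rfl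
    have q2 := ih _ (by have := comm b c; omega) m c b e rfl
    have q3 := ih _ (by have := comm b e; have := comm c e; omega) m e b c rfl
    have := comm b c; have := comm b e; have := comm c e
    refine ⟨?_, ?_, ?_⟩ <;> omega
  have far : ∀ a b c e, G.dist a b + G.dist a c + G.dist a e + G.dist b c + G.dist b e +
      G.dist c e = n → 2 ≤ G.dist a b → Q a b c e := by
    intro a b c e hn hab
    obtain ⟨m, hma, hmb, hm⟩ := h.exists_separates hG hab
    have hba := comm b a; have hca := comm c a; have hea := comm e a
    have hcb := comm c b; have heb := comm e b; have hec := comm e c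
    by_cases hac : Separates G m a c <;> by_cases hae : Separates G m a e
    · exact move m a b c e hn hma hm hac hae
    · have hbe := (hm.or e).resolve_left hae
      by_cases hbc : Separates G m b c
      · have := move m b a c e (by omega) hmb hm.symm hbc hbe.symm
        simp only [Q] at this ⊢
        omega
      · have hce := (hac.or e).resolve_left hae
        have h1 := hm.dist_eq hG
        have h2 := hac.dist_eq hG
        have h3 := hbe.dist_eq hG
        have h4 := hce.dist_eq hG
        have h5 := tri a m e
        have h6 := tri b m c
        have := comm m a; have := comm m b; have := comm m c; have := comm m e
        simp only [Q]
        omega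
    · have hbc := (hm.or c).resolve_left hac
      by_cases hbe : Separates G m b e
      · have := move m b a c e (by omega) hmb hm.symm hbc.symm hbe
        simp only [Q] at this ⊢
        omega
      · have hce := (hae.or c).resolve_left hac
        have h1 := hm.dist_eq hG
        have h2 := hae.dist_eq hG
        have h3 := hbc.dist_eq hG
        have h4 := hce.dist_eq hG
        have h5 := tri a m c
        have h6 := tri b m e
        have := comm m a; have := comm m b; have := comm m c; have := comm m e
        simp only [Q]
        omega
    · have hbc := (hm.or c).resolve_left hac
      have hbe := (hm.or e).resolve_left hae
      have := move m b a c e (by omega) hmb hm.symm hbc.symm hbe.symm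
      simp only [Q] at this ⊢
      omega
  intro a b c e hn
  have hba := comm b a; have hca := comm c a; have hea := comm e a
  have hcb := comm c b; have heb := comm e b; have hec := comm e c
  by_contra! hlt
  have hfar : ∀ x y z w, G.dist x y + G.dist x z + G.dist x w + G.dist y z + G.dist y w +
      G.dist z w = n → ¬ Q x y z w → G.dist x y ≤ 1 := by
    intro x y z w hs hQ
    by_contra! h2
    exact hQ (far x y z w hs h2)
  simp only [Q] at hfar
  have f1 := hfar a b c e (by omega) (by omega)
  have f2 := hfar a c b e (by omega) (by omega)
  have f3 := hfar a e b c (by omega) (by omega)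
  have f4 := hfar b c a e (by omega) (by omega)
  have f5 := hfar b e a c (by omega) (by omega)
  have f6 := hfar c e a b (by omega) (by omega)
  have t1 := tri a c b; have t2 := tri a e b; have t3 := tri c a e; have t4 := tri c b e
  omega

theorem isHyperbolic_zero_iff_isBlockGraph [Finite V] (hG : G.Connected) :
    IsHyperbolic G 0 ↔ IsBlockGraph G :=
  ⟨fun h _ hS => hS.prop.isClique_of_fourPoint hG (h.fourPoint (by norm_num)),
    fun h => (h.fourPoint hG).isHyperbolic (by norm_num)⟩

end BlockGraph

/-! ### A half-hyperbolic chain of 3-suns -/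

/-- The distances in the nine-vertex graph from which the examples are built: the path
`0, 1, 2, 3, 4, 5` together with the vertices `6, 7, 8`, where `1, 6, 7` form a triangle, `6` is
adjacent to `2` and `8`, and `7` is adjacent to `0` and `8`. The vertices other than `3, 4, 5` induce
a 3-sun with central triangle `1, 6, 7` and outer vertices `0, 2, 8`. -/
def cellDist : Fin 9 → Fin 9 → ℕ :=
  ![![0, 1, 2, 3, 4, 5, 2, 1, 2],
    ![1, 0, 1, 2, 3, 4, 1, 1, 2],
    ![2, 1, 0, 1, 2, 3, 1, 2, 2],
    ![3, 2, 1, 0, 1, 2, 2, 3, 3],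
    ![4, 3, 2, 1, 0, 1, 3, 4, 4],
    ![5, 4, 3, 2, 1, 0, 4, 5, 5],
    ![2, 1, 1, 2, 3, 4, 0, 1, 1],
    ![1, 1, 2, 3, 4, 5, 1, 0, 1],
    ![2, 2, 2, 3, 4, 5, 1, 1, 0]]

lemma cellDist_comm : ∀ a b, cellDist a b = cellDist b a := by decide

lemma cellDist_triangle : ∀ a b c, cellDist a c ≤ cellDist a b + cellDist b c := by
  decide +kernel

lemma cellDist_fourPoint : ∀ a b c e, cellDist a b + cellDist c e ≤
    max (cellDist a c + cellDist b e) (cellDist a e + cellDist b c) + 1 := by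
  decide +kernel

lemma exists_cellDist_step : ∀ a b, a ≠ b →
    ∃ a', cellDist a a' = 1 ∧ cellDist a' b + 1 = cellDist a b := by
  decide +kernel

section Glue

variable {α : Type*} {d : α → α → ℕ} {S T : Set α} {p q : α} {c l : ℕ}

/-- Four points, three of which lie in `S`, when `S` and `T` are joined by a path of length `l` from
`p ∈ S` to `q ∈ T`: the fourth point can be moved to `p`. -/
lemma FourPoint.three_one (hsymm : ∀ x y, d x y = d y x) (hS : FourPoint d c S) (hp : p ∈ S)
    (hd : ∀ a ∈ S, ∀ b ∈ T, d a b = d a p + l + d q b)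
    {u v w x : α} (hu : u ∈ S) (hv : v ∈ S) (hw : w ∈ S) (hx : x ∈ T) :
    d u v + d w x ≤ max (d u w + d v x) (d u x + d v w) + c ∧
    d u w + d v x ≤ max (d u v + d w x) (d u x + d v w) + c ∧
    d u x + d v w ≤ max (d u v + d w x) (d u w + d v x) + c := by
  have h1 := hS u hu v hv w hw p hp
  have h2 := hS u hu w hw v hv p hp
  have h3 := hS u hu p hp v hv w hw
  have e1 := hd u hu x hx
  have e2 := hd v hv x hx
  have e3 := hd w hw x hx
  have := hsymm w v
  have := hsymm p w
  have := hsymm p v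
  omega

/-- Joining two sets by a path does not increase the four-point defect. -/
lemma FourPoint.union (hsymm : ∀ x y, d x y = d y x) (htri : ∀ x y z, d x z ≤ d x y + d y z)
    (hS : FourPoint d c S) (hT : FourPoint d c T) (hp : p ∈ S) (hq : q ∈ T)
    (hd : ∀ a ∈ S, ∀ b ∈ T, d a b = d a p + l + d q b) : FourPoint d c (S ∪ T) := by
  have hd' : ∀ a ∈ T, ∀ b ∈ S, d a b = d a q + l + d p b := by
    intro a ha b hb
    rw [hsymm a b, hd b hb a ha, hsymm b p, hsymm q a]
    omega
  have two_two : ∀ u ∈ S, ∀ v ∈ S, ∀ w ∈ T, ∀ x ∈ T,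
      d u v + d w x ≤ max (d u w + d v x) (d u x + d v w) + c ∧
      d u w + d v x ≤ max (d u v + d w x) (d u x + d v w) + c ∧
      d u x + d v w ≤ max (d u v + d w x) (d u w + d v x) + c := by
    intro u hu v hv w hw x hx
    have e1 := hd u hu w hw
    have e2 := hd u hu x hx
    have e3 := hd v hv w hw
    have e4 := hd v hv x hx
    have t1 := htri u p v
    have t2 := htri w q x
    have := hsymm p v
    have := hsymm w q
    omega
  intro u hu v hv w hw x hx
  have := hsymm v u; have := hsymm w u; have := hsymm x u
  have := hsymm w v; have := hsymm x v; have := hsymm x w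
  rcases hu with hu | hu <;> rcases hv with hv | hv <;> rcases hw with hw | hw <;>
    rcases hx with hx | hx
  · exact hS u hu v hv w hw x hx
  · have := hS.three_one hsymm hp hd hu hv hw hx
    omega
  · have := hS.three_one hsymm hp hd hu hv hx hw
    omega
  · have := two_two u hu v hv w hw x hx
    omega
  · have := hS.three_one hsymm hp hd hu hw hx hv
    omega
  · have := two_two u hu w hw v hv x hx
    omega
  · have := two_two u hu x hx v hv w hw
    omega
  · have := hT.three_one hsymm hq hd' hv hw hx hu
    omega
  · have := hS.three_one hsymm hp hd hv hw hx hu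
    omega
  · have := two_two v hv w hw u hu x hx
    omega
  · have := two_two v hv x hx u hu w hw
    omega
  · have := hT.three_one hsymm hq hd' hu hw hx hv
    omega
  · have := two_two w hw x hx u hu v hv
    omega
  · have := hT.three_one hsymm hq hd' hu hv hx hw
    omega
  · have := hT.three_one hsymm hq hd' hu hv hw hx
    omega
  · exact hT u hu v hv w hw x hx

end Glue

/-- The distance between the vertices `s.2` of the cell number `s.1` and `t.2` of the cell number
`t.1`, when infinitely many copies of the nine-vertex cell are chained by joining the vertex `5` of
each cell to the vertex `0` of the next one. Crossing a cell and moving on to the next takes six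
steps. -/
def chainDist (s t : ℕ × Fin 9) : ℕ :=
  if s.1 = t.1 then cellDist s.2 t.2
  else if s.1 < t.1 then cellDist s.2 5 + 6 * (t.1 - s.1 - 1) + 1 + cellDist 0 t.2
  else cellDist s.2 0 + 6 * (s.1 - t.1 - 1) + 1 + cellDist 5 t.2

lemma chainDist_self_cell (i : ℕ) (a b : Fin 9) : chainDist (i, a) (i, b) = cellDist a b :=
  if_pos rfl

lemma chainDist_of_lt {i j : ℕ} (h : i < j) (a b : Fin 9) :
    chainDist (i, a) (j, b) = cellDist a 5 + 6 * (j - i - 1) + 1 + cellDist 0 b := by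
  simp [chainDist, h, h.ne]

lemma chainDist_of_gt {i j : ℕ} (h : j < i) (a b : Fin 9) :
    chainDist (i, a) (j, b) = cellDist a 0 + 6 * (i - j - 1) + 1 + cellDist 5 b := by
  simp [chainDist, h.ne', h.not_gt]

lemma chainDist_comm (s t : ℕ × Fin 9) : chainDist s t = chainDist t s := by
  obtain ⟨i, a⟩ := s
  obtain ⟨j, b⟩ := t
  rcases lt_trichotomy i j with h | rfl | h
  · rw [chainDist_of_lt h, chainDist_of_gt h, cellDist_comm a, cellDist_comm 0]
    omega
  · rw [chainDist_self_cell, chainDist_self_cell, cellDist_comm]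
  · rw [chainDist_of_lt h, chainDist_of_gt h, cellDist_comm a, cellDist_comm 5]
    omega

lemma cellDist_le : ∀ a b, cellDist a b ≤ 5 := by decide

lemma cellDist_self : ∀ a, cellDist a a = 0 := by decide

lemma eq_of_cellDist_eq_zero : ∀ a b, cellDist a b = 0 → a = b := by decide

lemma cellDist_zero_five : cellDist 0 5 = 5 := by decide

lemma chainDist_triangle (s t r : ℕ × Fin 9) : chainDist s r ≤ chainDist s t + chainDist t r := by
  obtain ⟨i, a⟩ := s
  obtain ⟨j, b⟩ := t
  obtain ⟨k, c⟩ := r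
  have h05 := cellDist_zero_five
  have h50 := (cellDist_comm 5 0).trans h05
  have t1 := cellDist_triangle a b c
  have t2 := cellDist_triangle a b 0
  have t3 := cellDist_triangle a b 5
  have t4 := cellDist_triangle 0 b c
  have t5 := cellDist_triangle 5 b c
  have t6 := cellDist_triangle a 0 c
  have t7 := cellDist_triangle a 5 c
  have t8 := cellDist_triangle 0 b 5
  have t9 := cellDist_triangle 5 b 0
  have l1 := cellDist_le a 0
  have l2 := cellDist_le a 5
  have l3 := cellDist_le 0 c
  have l4 := cellDist_le 5 c
  unfold chainDist
  dsimp only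
  split_ifs <;> omega

lemma chainDist_eq_zero_iff {s t : ℕ × Fin 9} : chainDist s t = 0 ↔ s = t := by
  obtain ⟨i, a⟩ := s
  obtain ⟨j, b⟩ := t
  rcases lt_trichotomy i j with h | rfl | h
  · simp [chainDist_of_lt h, h.ne]
  · rw [chainDist_self_cell, Prod.mk.injEq]
    exact ⟨fun h => ⟨rfl, eq_of_cellDist_eq_zero _ _ h⟩, fun h => h.2 ▸ cellDist_self a⟩
  · simp [chainDist_of_gt h, h.ne']

/-- The chain distance is the distance of a graph: from every point one can move one step closer to
any other point, through cells that are not beyond the two points. -/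
lemma exists_chainDist_step {s t : ℕ × Fin 9} (hst : s ≠ t) :
    ∃ r, chainDist s r = 1 ∧ chainDist r t + 1 = chainDist s t ∧ r.1 ≤ max s.1 t.1 := by
  obtain ⟨i, a⟩ := s
  obtain ⟨j, b⟩ := t
  have h05 := cellDist_zero_five
  have h50 := (cellDist_comm 5 0).trans h05
  rcases lt_trichotomy i j with h | rfl | h
  · by_cases ha : a = 5
    · subst ha
      refine ⟨(i + 1, 0), ?_, ?_, le_max_of_le_right h⟩
      · simp [chainDist_of_lt (Nat.lt_succ_self i), cellDist_self]
      · rw [chainDist_of_lt h, cellDist_self]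
        rcases (Nat.succ_le_of_lt h).eq_or_lt with rfl | h'
        · rw [chainDist_self_cell]
          omega
        · rw [chainDist_of_lt h', h05]
          omega
    · obtain ⟨a', h1, h2⟩ := exists_cellDist_step a 5 ha
      refine ⟨(i, a'), by rwa [chainDist_self_cell], ?_, by simp⟩
      rw [chainDist_of_lt h, chainDist_of_lt h]
      omega
  · obtain ⟨a', h1, h2⟩ := exists_cellDist_step a b (fun e => hst (by rw [e]))
    exact ⟨(i, a'), by rwa [chainDist_self_cell], by simpa only [chainDist_self_cell], by simp⟩
  · by_cases ha : a = 0
    · subst ha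
      obtain ⟨i, rfl⟩ : ∃ i', i = i' + 1 := ⟨i - 1, by omega⟩
      refine ⟨(i, 5), ?_, ?_, by simp⟩
      · simp [chainDist_of_gt (Nat.lt_succ_self i), cellDist_self]
      · rw [chainDist_of_gt h, cellDist_self]
        rcases (Nat.le_of_lt_succ h).eq_or_lt with rfl | h'
        · rw [chainDist_self_cell]
          omega
        · rw [chainDist_of_gt h', h50]
          omega
    · obtain ⟨a', h1, h2⟩ := exists_cellDist_step a 0 ha
      refine ⟨(i, a'), by rwa [chainDist_self_cell], ?_, by simp⟩
      rw [chainDist_of_gt h, chainDist_of_gt h]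
      omega

lemma fourPoint_chainDist (n : ℕ) : FourPoint chainDist 1 {s | s.1 ≤ n} := by
  have hcell : ∀ m, FourPoint chainDist 1 {s | s.1 = m} := by
    rintro m ⟨_, a⟩ rfl ⟨_, b⟩ rfl ⟨_, c⟩ rfl ⟨_, e⟩ rfl
    simp only [chainDist_self_cell]
    exact cellDist_fourPoint a b c e
  induction n with
  | zero => simpa using hcell 0
  | succ n ih =>
    have hunion := ih.union (p := (n, 5)) (q := (n + 1, 0)) (l := 1) chainDist_comm
      chainDist_triangle (hcell (n + 1)) (le_refl n) rfl ?_
    · convert hunion using 1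
      ext s
      exact Nat.le_succ_iff
    · rintro ⟨i, a⟩ (hi : i ≤ n) ⟨_, b⟩ rfl
      have h05 := cellDist_zero_five
      rw [chainDist_of_lt (Nat.lt_succ_of_le hi), chainDist_self_cell]
      rcases hi.eq_or_lt with rfl | hi
      · rw [chainDist_self_cell]
        omega
      · rw [chainDist_of_lt hi]
        omega

/-- The chain of `k` cells. -/
def chainGraph (k : ℕ) : SimpleGraph (Fin k × Fin 9) where
  Adj s t := chainDist (s.1, s.2) (t.1, t.2) = 1
  symm := ⟨fun s t h => by rwa [chainDist_comm]⟩
  loopless := ⟨fun s h => by rw [chainDist_eq_zero_iff.2 rfl] at h; omega⟩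

lemma exists_walk_chainGraph {k : ℕ} (t : Fin k × Fin 9) : ∀ (n : ℕ) (s : Fin k × Fin 9),
    chainDist (s.1, s.2) (t.1, t.2) = n → ∃ p : (chainGraph k).Walk s t, p.length = n := by
  intro n
  induction n with
  | zero =>
    intro s hs
    obtain rfl : s = t := by simpa [Prod.ext_iff, Fin.ext_iff] using chainDist_eq_zero_iff.1 hs
    exact ⟨.nil, rfl⟩
  | succ n ih =>
    intro s hs
    obtain ⟨⟨j, b⟩, h1, h2, h3⟩ := exists_chainDist_step (s := (s.1, s.2)) (t := (t.1, t.2))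
      fun e => by rw [chainDist_eq_zero_iff.2 e] at hs; omega
    have hj : j < k := h3.trans_lt (max_lt s.1.2 t.1.2)
    obtain ⟨p, hp⟩ := ih (⟨j, hj⟩, b) (by dsimp only; omega)
    have hadj : (chainGraph k).Adj s (⟨j, hj⟩, b) := h1
    exact ⟨.cons hadj p, by rw [SimpleGraph.Walk.length_cons, hp]⟩

lemma chainGraph_connected {k : ℕ} (hk : 0 < k) : (chainGraph k).Connected where
  preconnected s t := ⟨(exists_walk_chainGraph t _ s rfl).choose⟩
  nonempty := ⟨(⟨0, hk⟩, 0)⟩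

lemma dist_chainGraph {k : ℕ} (s t : Fin k × Fin 9) :
    (chainGraph k).dist s t = chainDist (s.1, s.2) (t.1, t.2) := by
  obtain ⟨p, hp⟩ := exists_walk_chainGraph t _ s rfl
  refine le_antisymm (hp ▸ SimpleGraph.dist_le p) ?_
  obtain ⟨q, hq⟩ := p.reachable.exists_walk_length_eq_dist
  rw [← hq]
  clear hq hp p
  induction q with
  | nil => exact (chainDist_eq_zero_iff.2 rfl).le
  | @cons a b c hab q ih =>
    have hab' : chainDist (a.1, a.2) (b.1, b.2) = 1 := hab
    have := chainDist_triangle (a.1, a.2) (b.1, b.2) (c.1, c.2)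
    rw [SimpleGraph.Walk.length_cons]
    omega

lemma isHyperbolic_chainGraph (k : ℕ) : IsHyperbolic (chainGraph k) (1 / 2) := by
  refine FourPoint.isHyperbolic (c := 1) ?_ (by norm_num)
  intro u _ v _ w _ x _
  simp only [dist_chainGraph]
  exact fourPoint_chainDist k _ u.1.2.le _ v.1.2.le _ w.1.2.le _ x.1.2.le

/-! ### The duality gap of the chain -/

/-- Four times the weights of a fractional multipacking of the chain: `1/2` on the outer vertices of
the 3-sun and `1/4` on the three path vertices. -/
def cellWeight : Fin 9 → ℕ := ![2, 0, 2, 1, 1, 1, 0, 0, 2]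

lemma sum_cellWeight : ∑ b, cellWeight b = 9 := by decide

/-- The weight within distance `r` in the first `m` of the cells lying on one side of a point, where
`e` is the distance in a cell from its nearer end, and this end is at distance `o` in the first
cell. -/
def tailWeight (e : Fin 9 → ℕ) (r o m : ℕ) : ℕ :=
  ∑ n ∈ Finset.range m, ∑ b, if o + 6 * n + e b ≤ r then cellWeight b else 0

lemma tailWeight_succ (e : Fin 9 → ℕ) (r o m : ℕ) : tailWeight e r o (m + 1) =
    tailWeight e r (o + 6) m + ∑ b, if o + e b ≤ r then cellWeight b else 0 := by
  have h : ∀ n, o + 6 + 6 * n = o + 6 * (n + 1) := fun n => by ring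
  simp only [tailWeight, Finset.sum_range_succ', h, Nat.mul_zero, Nat.add_zero]

lemma tailWeight_of_lt {e : Fin 9 → ℕ} {r o : ℕ} (m : ℕ) (h : r < o) : tailWeight e r o m = 0 := by
  refine Finset.sum_eq_zero fun n _ => Finset.sum_eq_zero fun b _ => if_neg ?_
  omega

/-- A radius that does not reach the second cell only sees the first one. -/
lemma tailWeight_le_first {e : Fin 9 → ℕ} {r o : ℕ} (m : ℕ) (h : r < o + 6) :
    tailWeight e r o m ≤ ∑ b, if o + e b ≤ r then cellWeight b else 0 := by
  cases m with
  | zero => exact Nat.zero_le _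
  | succ m => rw [tailWeight_succ, tailWeight_of_lt m h, zero_add]

lemma sum_ite_cellWeight_le (P : Fin 9 → Prop) [DecidablePred P] :
    ∑ b, (if P b then cellWeight b else 0) ≤ 9 := by
  refine (Finset.sum_le_sum fun b _ => ?_).trans sum_cellWeight.le
  split_ifs <;> simp

/-- The weight on one side grows on average by `9` for every `6` steps; it is enough to bound it
inside the first cell. -/
lemma tailWeight_le {e : Fin 9 → ℕ} {C : ℕ}
    (he : ∀ s : Fin 6, 2 * ∑ b, (if e b ≤ (s : ℕ) then cellWeight b else 0) ≤ 3 * s + C) (r m : ℕ) :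
    ∀ o ≤ r, 2 * tailWeight e r o m ≤ 3 * (r - o) + C := by
  induction m with
  | zero => simp [tailWeight]
  | succ m ih =>
    intro o ho
    rcases lt_or_ge r (o + 6) with h | h
    · have h1 := tailWeight_le_first (e := e) (m + 1) h
      have h2 := he ⟨r - o, by omega⟩
      have h3 : ∀ b, o + e b ≤ r ↔ e b ≤ r - o := fun b => by omega
      simp only [h3] at h1
      dsimp only at h2
      omega
    · have h1 := ih _ h
      have h2 := sum_ite_cellWeight_le fun b => o + e b ≤ r
      rw [tailWeight_succ]
      omega

lemma right_le : ∀ s : Fin 6,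
    2 * ∑ b, (if cellDist 0 b ≤ (s : ℕ) then cellWeight b else 0) ≤ 3 * s + 6 := by
  decide

lemma left_le : ∀ s : Fin 6,
    2 * ∑ b, (if cellDist 5 b ≤ (s : ℕ) then cellWeight b else 0) ≤ 3 * s + 3 := by
  decide

/-- The weight bound for balls of small radius, which reach only the two neighbouring cells. -/
lemma small_ball_weight_le : ∀ (a : Fin 9) (r : Fin 6), 1 ≤ (r : ℕ) →
    (∑ b, if cellDist a b ≤ (r : ℕ) then cellWeight b else 0) +
    (∑ b, if cellDist a 5 + 1 + cellDist 0 b ≤ (r : ℕ) then cellWeight b else 0) +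
    (∑ b, if cellDist a 0 + 1 + cellDist 5 b ≤ (r : ℕ) then cellWeight b else 0) ≤ 4 * r := by
  decide +kernel

lemma sum_ball_cellWeight {k : ℕ} (i : Fin k) (a : Fin 9) (r : ℕ) :
    ∑ u with (chainGraph k).dist (i, a) u ≤ r, cellWeight u.2 =
      tailWeight (cellDist 5) r (cellDist a 0 + 1) i +
      (∑ b, if cellDist a b ≤ r then cellWeight b else 0) +
      tailWeight (cellDist 0) r (cellDist a 5 + 1) (k - (i + 1)) := by
  let F : ℕ → ℕ := fun j => ∑ b, if chainDist (i, a) (j, b) ≤ r then cellWeight b else 0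
  have h1 : ∑ u with (chainGraph k).dist (i, a) u ≤ r, cellWeight u.2 = ∑ j : Fin k, F j := by
    simp only [dist_chainGraph]
    rw [Finset.sum_filter, Fintype.sum_prod_type]
  have h2 : Finset.range k = Finset.range ((i + 1) + (k - (i + 1))) := by
    congr 1
    omega
  rw [h1, Fin.sum_univ_eq_sum_range, h2, Finset.sum_range_add, Finset.sum_range_succ]
  congr 1
  · congr 1
    · rw [← Finset.sum_range_reflect]
      refine Finset.sum_congr rfl fun n hn => Finset.sum_congr rfl fun b _ => ?_
      rw [Finset.mem_range] at hn
      rw [chainDist_of_gt (by omega)]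
      refine if_congr ?_ rfl rfl
      omega
    · simp only [F, chainDist_self_cell]
  · refine Finset.sum_congr rfl fun n hn => Finset.sum_congr rfl fun b _ => ?_
    rw [chainDist_of_lt (by omega)]
    refine if_congr ?_ rfl rfl
    omega

lemma sum_ball_cellWeight_le {k : ℕ} (v : Fin k × Fin 9) (r : ℕ) (hr : 1 ≤ r) :
    ∑ u with (chainGraph k).dist v u ≤ r, cellWeight u.2 ≤ 4 * r := by
  obtain ⟨i, a⟩ := v
  rw [sum_ball_cellWeight]
  rcases lt_or_ge r 6 with h | h
  · have h1 := tailWeight_le_first (e := cellDist 5) (r := r) (o := cellDist a 0 + 1) i (by omega)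
    have h2 := tailWeight_le_first (e := cellDist 0) (r := r) (o := cellDist a 5 + 1)
      (k - (i + 1)) (by omega)
    have h3 := small_ball_weight_le a ⟨r, h⟩ hr
    dsimp only at h3
    omega
  · have l1 := cellDist_le a 0
    have l2 := cellDist_le a 5
    have h1 := tailWeight_le left_le r i (cellDist a 0 + 1) (by omega)
    have h2 := tailWeight_le right_le r (k - (i + 1)) (cellDist a 5 + 1) (by omega)
    have h3 := sum_ite_cellWeight_le fun b => cellDist a b ≤ r
    have h4 := cellDist_triangle 0 a 5
    have h5 := cellDist_comm 0 a
    have h6 := cellDist_zero_five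
    omega

lemma le_broadcastNumber_chainGraph {k : ℕ} (hk : 0 < k) :
    9 * k ≤ 4 * broadcastNumber (chainGraph k) := by
  have : Nontrivial (Fin k × Fin 9) := ⟨(⟨0, hk⟩, 0), (⟨0, hk⟩, 1), by simp⟩
  obtain ⟨f, hf, hsum⟩ := exists_broadcast_eq (chainGraph_connected hk)
  have h := sum_weight_le (w := fun u : Fin k × Fin 9 => cellWeight u.2) (D := 4)
    (fun v r hr => by convert sum_ball_cellWeight_le v r hr) hf
  rw [Fintype.sum_prod_type, hsum] at h
  simp only [sum_cellWeight, Finset.sum_const, Finset.card_univ, Fintype.card_fin,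
    smul_eq_mul] at h
  omega

open Classical in
/-- A multipacking has at most two vertices in each cell: at most one on the path `3, 4, 5`, and at
most one in the 3-sun, since adding up the bounds for the closed neighbourhoods of the three central
vertices counts every vertex of the sun at least twice. -/
lemma IsMultipacking.sum_cell_le {k : ℕ} {M : Set (Fin k × Fin 9)}
    (hM : IsMultipacking (chainGraph k) M) (i : Fin k) :
    ∑ b : Fin 9, (if (i, b) ∈ M then 1 else 0) ≤ 2 := by
  set g : Fin 9 → ℕ := fun b => if (i, b) ∈ M then 1 else 0
  have hball : ∀ a, ∑ b, (if cellDist a b ≤ 1 then g b else 0) ≤ 1 := by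
    intro a
    refine le_trans ?_ (hM (i, a) 1 le_rfl)
    rw [← sum_ball_indicator, ← Finset.sum_filter]
    refine (Finset.sum_map (Finset.univ.filter fun b => cellDist a b ≤ 1)
      (Function.Embedding.sectR i (Fin 9)) (fun u => if u ∈ M then 1 else 0)).symm.trans_le ?_
    refine Finset.sum_le_sum_of_subset fun u hu => ?_
    obtain ⟨b, hb, rfl⟩ := Finset.mem_map.1 hu
    rw [Finset.mem_filter] at hb ⊢
    refine ⟨Finset.mem_univ _, ?_⟩
    rw [dist_chainGraph]
    exact (chainDist_self_cell _ _ _).trans_le hb.2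
  have h1 := hball 1
  have h4 := hball 4
  have h6 := hball 6
  have h7 := hball 7
  clear_value g
  simp [Fin.sum_univ_succ, cellDist] at h1 h4 h6 h7 ⊢
  omega

lemma multipackingNumber_chainGraph_le (k : ℕ) : multipackingNumber (chainGraph k) ≤ 2 * k := by
  classical
  refine multipackingNumber_le fun M hM => ?_
  have h : M.ncard = ∑ u, if u ∈ M then 1 else 0 := by
    rw [Finset.sum_boole, Nat.cast_id, ← Set.ncard_coe_finset, Finset.coe_filter_univ,
      Set.ofPred_mem_eq]
  rw [h, Fintype.sum_prod_type]
  refine (Finset.sum_le_card_nsmul _ _ 2 fun i _ => hM.sum_cell_le i).trans ?_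
  simp [mul_comm]

lemma hasUnboundedGap_half : HasUnboundedGap (1 / 2) := by
  intro N
  -- Each cell contributes at least `9/4 - 2 = 1/4` to the gap.
  have hk : 0 < 4 * (N + 1) := by omega
  refine ⟨Fin (4 * (N + 1)) × Fin 9, inferInstance, ⟨(⟨0, hk⟩, 0), (⟨0, hk⟩, 1), by simp⟩,
    chainGraph _, chainGraph_connected hk, isHyperbolic_chainGraph _, ?_⟩
  have h1 := le_broadcastNumber_chainGraph hk
  have h2 := multipackingNumber_chainGraph_le (4 * (N + 1))
  omega

lemma half_le_of_hasUnboundedGap {δ : ℝ} (h : HasUnboundedGap δ) : 1 / 2 ≤ δ := by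
  by_contra! hδ
  obtain ⟨V, _, _, G, hG, hyp, hgap⟩ := h 1
  have := broadcastNumber_eq_multipackingNumber hG (hyp.fourPoint (by push_cast; linarith))
  omega

end BroadcastMultipacking

theorem mainTheorem8 :
    IsLeast {δ : ℝ | HasUnboundedGap δ} (1 / 2) ∧
    (∀ {V : Type*} [Fintype V] (G : SimpleGraph V), G.Connected →
      (IsHyperbolic G 0 ↔ IsBlockGraph G)) ∧
    (∀ {V : Type*} [Fintype V] [Nontrivial V] (G : SimpleGraph V), G.Connected →
      IsHyperbolic G 0 → broadcastNumber G = multipackingNumber G) :=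
  ⟨⟨hasUnboundedGap_half, fun _ h => half_le_of_hasUnboundedGap h⟩,
    fun _ hG => isHyperbolic_zero_iff_isBlockGraph hG,
    fun _ hG h => broadcastNumber_eq_multipackingNumber hG (h.fourPoint (by norm_num))⟩
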